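/- Let $\nu$ be a Lévy measure on $\mathbb{R}$ (that is, $\nu(\{0\})=0$ and $\int (x^2\wedge 1)\,\nu(dx)<\infty$), and let $X$ be a Lévy process with generating triplet $(0,0,\nu)$, where the generating triplet $(c,\sigma^2,\nu)$ is understood with the truncation function $\mathbf 1_{\{|x|\le 1\}}$, i.e. $$\mathbb{E}\,e^{iuX(t)}=\exp\Big(t\Big(icu-\tfrac{\sigma^2u^2}{2}+\int\big(e^{iux}-1-iux\mathbf 1_{\{|x|\le1\}}\big)\,\nu(dx)\Big)\Big).$$ Let $\gamma_0>0$, $\alpha\in(0,2)$, $\epsilon\in(0,2-\alpha)$, and suppose that there is a Borel measure $\mu$ on $\mathbb{R}$ such that - $\mu(B)\le\nu(B)$ for every Borel set $B\subseteq(-\gamma_0,\gamma_0)$; - the function $f(x)=\mu\big((-\infty,-x]\cup[x,\infty)\big)$ takes values in $(0,\infty)$ for $x\in(0,\infty)$ and is regularly varying at $0$ with index $-(\alpha+\epsilon)$, i.e. $\lim_{x\to\infty} f(1/(sx))/f(1/x)=s^{\alpha+\epsilon}$ for every $s>0$. Then: 1. There is a constant $C<\infty$ such that for every $\gamma\ge\gamma_0$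 and every $t>0$, if $X^{<\gamma}$ denotes the Lévy process with generating triplet $(0,0,\nu|_{(-\gamma,\gamma)})$, the law of $X^{<\gamma}(t)$ has a density $f_{X^{<\gamma}(t)}$ with respect to Lebesgue measure, and $$\|f_{X^{<\gamma}(t)}\|_\infty\le\frac{C}{t^{1/\alpha}\wedge 1}.$$ 2. For every $z_0>0$ there exist $C>0$ and $a>0$ such that for all $z\ge z_0$, $t>0$, $x\in\mathbb{R}$ and $\delta\in[0,1]$, $$\mathbb{P}\big(Y^{<z}(t)\in[x,x+\delta]\big)\le\frac{C}{t^{a}\wedge1}\,\delta,$$ where $Y^{<z}$ is the Lévy process with generating triplet $(0,0,\nu|_{(-\infty,z)})$. -/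

import Mathlib

open MeasureTheory ProbabilityTheory Filter Topology Set
open scoped NNReal ENNReal

universe u

/-- A Lévy measure on `ℝ`: no mass at the origin and `∫ (x² ∧ 1) ν(dx) < ∞`. -/
structure IsLevyMeasure (ν : Measure ℝ) : Prop where
  zero : ν {0} = 0
  lintegral_lt_top : ∫⁻ x, ENNReal.ofReal (min (x ^ 2) 1) ∂ν < ∞

/-- The Lévy–Khintchine exponent of the triplet `(c, σ², ν)`, with the truncation function
`1_{|x| ≤ 1}`; the argument `σsq` is the variance `σ²` of the Brownian part. -/
noncomputable def levyExponent (c : ℝ) (σsq : ℝ≥0) (ν : Measure ℝ) (u : ℝ) : ℂ :=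
  Complex.I * (c : ℂ) * (u : ℂ) - (σsq : ℂ) * (u : ℂ) ^ 2 / 2
    + ∫ x, (Complex.exp (Complex.I * (u : ℂ) * (x : ℂ)) - 1
        - Complex.I * (u : ℂ) * (if |x| ≤ 1 then (x : ℂ) else 0)) ∂ν

/-- A real-valued Lévy process on the probability space `(Ω, P)`: it starts at `0`, has independent
and stationary increments, is continuous in probability, and almost all its paths are
right-continuous with left limits. -/
structure IsLevyProcess {Ω : Type*} [MeasurableSpace Ω] (X : ℝ≥0 → Ω → ℝ) (P : Measure Ω) :
    Prop where
  measurable : ∀ t, Measurable (X t)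
  zero : ∀ᵐ ω ∂P, X 0 ω = 0
  indep : HasIndepIncrements X P
  stationary : ∀ s t, IdentDistrib (fun ω => X (s + t) ω - X s ω) (fun ω => X t ω - X 0 ω) P P
  continuous_in_probability : ∀ t, TendstoInMeasure P X (𝓝 t) (X t)
  cadlag : ∀ᵐ ω ∂P, ∀ t, ContinuousWithinAt (fun s => X s ω) (Ioi t) t ∧
    ∃ l, Tendsto (fun s => X s ω) (𝓝[<] t) (𝓝 l)

/-- `X` is a Lévy process with generating triplet `(c, σ², ν)`. -/
structure IsLevyProcessWithTriplet {Ω : Type*} [MeasurableSpace Ω] (X : ℝ≥0 → Ω → ℝ)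
    (P : Measure Ω) (c : ℝ) (σsq : ℝ≥0) (ν : Measure ℝ) : Prop where
  isLevyProcess : IsLevyProcess X P
  isLevyMeasure : IsLevyMeasure ν
  charFun_eq : ∀ (t : ℝ≥0) (u : ℝ),
    charFun (P.map (X t)) u = Complex.exp ((t : ℂ) * levyExponent c σsq ν u)

/-- `φ : (0,∞) → (0,∞)` is Borel measurable and regularly varying at `+∞` with index `ρ`.
Only the values of `φ` on `(0,∞)` matter. -/
structure RegularlyVaryingAtTop (φ : ℝ → ℝ) (ρ : ℝ) : Prop where
  measurable : Measurable (fun x : Ioi (0 : ℝ) => φ x)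
  pos : ∀ x, 0 < x → 0 < φ x
  tendsto : ∀ t, 0 < t → Tendsto (fun x => φ (t * x) / φ x) atTop (𝓝 (t ^ ρ))

/-- `h : (0,∞) → (0,∞)` is regularly varying at `0` with index `ρ`: the function `x ↦ h (1 / x)`
is regularly varying at `+∞` with index `-ρ`. -/
def RegularlyVaryingAtZero (h : ℝ → ℝ) (ρ : ℝ) : Prop :=
  RegularlyVaryingAtTop (fun x => h (1 / x)) (-ρ)

/-- The distributional assumption with smoothness exponent `θ` on the Lévy processes with triplet
`(c, σ², ν)`: for every `z₀ > 0` there are `C, a > 0` such that for all `z ≥ z₀`, the Lévy process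
`X^{<z}` with triplet `(c, σ², ν|_{(-∞, z)})`, that is, without the jumps of size at least `z`,
satisfies `P(X^{<z}(t) ∈ [x, x + δ]) ≤ C δ^θ / (t^a ∧ 1)` for all `t > 0`, `x ∈ ℝ`,
`δ ∈ [0, 1]`. -/
def SmallJumpAnticoncentration (c : ℝ) (σsq : ℝ≥0) (ν : Measure ℝ) (θ : ℝ) : Prop :=
  ∀ z₀ : ℝ, 0 < z₀ → ∃ C : ℝ, 0 < C ∧ ∃ a : ℝ, 0 < a ∧
    ∀ z : ℝ, z₀ ≤ z →
    ∀ (Ω : Type u) [MeasurableSpace Ω] (P : Measure Ω) [IsProbabilityMeasure P]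
      (Y : ℝ≥0 → Ω → ℝ), IsLevyProcessWithTriplet Y P c σsq (ν.restrict (Iio z)) →
    ∀ t : ℝ≥0, 0 < t → ∀ x δ : ℝ, δ ∈ Icc (0 : ℝ) 1 →
      P.real (Y t ⁻¹' Icc x (x + δ)) ≤ C / min ((t : ℝ) ^ a) 1 * δ ^ θ

/-!
By Fourier inversion, tested against nonnegative functions, a finite measure `P` on `ℝ^d` with
integrable characteristic function is at most `(2π)^{-d} ‖charFun P‖₁` times Lebesgue measure.

For a Lévy process with exponent `ψ`, the characteristic function at time `t` has norm
`exp (t Re ψ)`, and `-Re ψ(u) ≥ ∫ (1 - cos (u x)) ν(dx)` is at least a constant times the mass of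
the annulus `1 / (2|u|) ≤ |x| < 1 / |u|`. For large `|u|` this mass may be computed with `μ`.
Regular variation makes the tail `φ(u) = μ(|x| ≥ 1 / u)` satisfy `φ(2u) ≥ 2^α φ(u)` eventually, so
both `φ(u)` and the annulus mass `φ(2u) - φ(u)` are at least a constant times `u^α`. Hence
`|charFun| ≤ exp (-k t |u|^α)` outside a bounded interval that does not depend on `t`, and the
`L¹` norm is `O(1 + t^{-1/α})`, with constants that involve `μ` only.
-/

section TestFunctions

variable {V : Type*} [NormedAddCommGroup V] [NormedSpace ℝ V] [FiniteDimensional ℝ V]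

theorem exists_contDiff_indicator_le_le_indicator {K U : Set V} (hK : IsCompact K)
    (hU : IsOpen U) (hKU : K ⊆ U) :
    ∃ g : V → ℝ, ContDiff ℝ (⊤ : ℕ∞) g ∧ HasCompactSupport g ∧
      K.indicator 1 ≤ g ∧ g ≤ U.indicator 1 := by
  obtain ⟨δ, hδ, hsub⟩ := hK.exists_cthickening_subset_open hU hKU
  obtain ⟨g, hsmooth, hrange, hsupp, hone⟩ :=
    exists_contMDiff_support_eq_eq_one_iff (modelWithCornersSelf ℝ V) (n := (⊤ : ℕ∞))
      Metric.isOpen_thickening hK.isClosed (Metric.self_subset_thickening hδ K)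
  have hg : ∀ x, g x ∈ Icc (0 : ℝ) 1 := fun x => hrange (mem_range_self x)
  have hsupp_sub : Function.support g ⊆ Metric.cthickening δ K :=
    hsupp.trans_subset (Metric.thickening_subset_cthickening δ K)
  refine ⟨g, hsmooth.contDiff,
    HasCompactSupport.of_support_subset_isCompact hK.cthickening hsupp_sub,
    indicator_le' (fun x hx => ((hone x).1 hx).ge) fun x _ => (hg x).1,
    fun x => ?_⟩
  by_cases hx : x ∈ U
  · rw [indicator_of_mem hx]
    exact (hg x).2
  · rw [indicator_of_notMem hx]
    exact (Function.notMem_support.1 fun h => hx (hsub (hsupp_sub h))).le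

theorem le_of_forall_isCompact_isOpen_le {X : Type*} [TopologicalSpace X] [MeasurableSpace X]
    {P Q : Measure X} [P.InnerRegular] [Q.OuterRegular]
    (h : ∀ K U : Set X, IsCompact K → IsOpen U → K ⊆ U → P K ≤ Q U) : P ≤ Q := by
  refine Measure.le_iff.2 fun s hs => ?_
  rw [hs.measure_eq_iSup_isCompact P]
  refine iSup₂_le fun K hKs => iSup_le fun hK => le_trans ?_ (measure_mono hKs)
  rw [K.measure_eq_iInf_isOpen Q]
  exact le_iInf₂ fun U hKU => le_iInf fun hU => h K U hK hU hKU

theorem le_of_forall_integral_contDiff_le [MeasurableSpace V] [BorelSpace V] {P Q : Measure V}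
    [IsLocallyFiniteMeasure P] [IsLocallyFiniteMeasure Q]
    (h : ∀ g : V → ℝ, ContDiff ℝ (⊤ : ℕ∞) g → HasCompactSupport g → (∀ x, 0 ≤ g x) →
      ∫ x, g x ∂P ≤ ∫ x, g x ∂Q) : P ≤ Q := by
  refine le_of_forall_isCompact_isOpen_le fun K U hK hU hKU => ?_
  obtain ⟨g, hsmooth, hsupp, hKg, hgU⟩ := exists_contDiff_indicator_le_le_indicator hK hU hKU
  have hg : ∀ x, 0 ≤ g x := fun x => (indicator_nonneg (fun _ _ => zero_le_one) x).trans (hKg x)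
  have hlintegral : ∀ μ : Measure V, [IsLocallyFiniteMeasure μ] →
      ENNReal.ofReal (∫ x, g x ∂μ) = ∫⁻ x, ENNReal.ofReal (g x) ∂μ := fun μ _ =>
    ofReal_integral_eq_lintegral_ofReal
      (hsmooth.continuous.integrable_of_hasCompactSupport hsupp) (ae_of_all _ hg)
  have hindicator : ∀ (s : Set V) (x : V),
      s.indicator 1 x = ENNReal.ofReal (s.indicator 1 x) := fun s x => by
    by_cases hx : x ∈ s <;> simp [hx]
  calc P K = ∫⁻ x, K.indicator 1 x ∂P := (lintegral_indicator_one hK.measurableSet).symm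
    _ ≤ ∫⁻ x, ENNReal.ofReal (g x) ∂P := lintegral_mono fun x => by
        rw [hindicator]
        exact ENNReal.ofReal_le_ofReal (hKg x)
    _ ≤ ∫⁻ x, ENNReal.ofReal (g x) ∂Q := by
        rw [← hlintegral, ← hlintegral]
        exact ENNReal.ofReal_le_ofReal (h g hsmooth hsupp hg)
    _ ≤ ∫⁻ x, U.indicator 1 x ∂Q := lintegral_mono fun x => by
        rw [hindicator]
        exact ENNReal.ofReal_le_ofReal (hgU x)
    _ = Q U := lintegral_indicator_one hU.measurableSet

end TestFunctions

section FourierInversion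

open scoped FourierTransform

variable {V : Type*} [NormedAddCommGroup V] [InnerProductSpace ℝ V] [FiniteDimensional ℝ V]
  [MeasurableSpace V] [BorelSpace V]

/- The factor `-2π` converts between the characters `e^{i⟨x, u⟩}` of `charFun` and
`e^{-2πi⟨x, ξ⟩}` of `𝓕`. -/
theorem integral_eq_integral_charFun_smul_fourierInv (g : SchwartzMap V ℂ)
    (P : Measure V) [IsFiniteMeasure P] :
    ∫ x, g x ∂P = ∫ ξ, charFun P ((-(2 * Real.pi)) • ξ) • (𝓕⁻ g : SchwartzMap V ℂ) ξ := by
  have hcharFun : ∀ ξ : V, charFun P ((-(2 * Real.pi)) • ξ)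
      = VectorFourier.fourierIntegral Real.fourierChar P (innerₗ V) (fun _ => 1) ξ := fun ξ => by
    rw [charFun_eq_fourierIntegral', smul_smul, neg_mul_neg,
      inv_mul_cancel₀ Real.two_pi_pos.ne', one_smul]
    rfl
  have hinv : ∀ x, VectorFourier.fourierIntegral Real.fourierChar volume (innerₗ V).flip
      ⇑(𝓕⁻ g : SchwartzMap V ℂ) x = g x := fun x => by
    rw [flip_innerₗ]
    exact DFunLike.congr_fun
      (FourierTransform.fourier_fourierInv_eq g : 𝓕 (𝓕⁻ g : SchwartzMap V ℂ) = g) x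
  simp_rw [hcharFun]
  rw [VectorFourier.integral_fourierIntegral_smul_eq_flip Real.continuous_fourierChar
    continuous_inner (integrable_const 1) (𝓕⁻ g).integrable]
  simp only [hinv, one_smul]

theorem le_smul_volume_of_integrable_charFun {P : Measure V} [IsFiniteMeasure P]
    (hP : Integrable (charFun P)) :
    P ≤ ENNReal.ofReal (((2 * Real.pi) ^ Module.finrank ℝ V)⁻¹ * ∫ u, ‖charFun P u‖) • volume := by
  set κ : ℝ := ((2 * Real.pi) ^ Module.finrank ℝ V)⁻¹ * ∫ u, ‖charFun P u‖
  have hκ : 0 ≤ κ := by positivity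
  have hscale : ∫ ξ : V, ‖charFun P ((-(2 * Real.pi)) • ξ)‖ = κ := by
    rw [Measure.integral_comp_smul volume (fun u => ‖charFun P u‖), abs_inv, abs_pow, abs_neg,
      abs_of_pos Real.two_pi_pos, smul_eq_mul]
  change P ≤ κ.toNNReal • volume
  refine le_of_forall_integral_contDiff_le fun g hsmooth hsupp hg => ?_
  set G : SchwartzMap V ℂ := (hsupp.comp_left Complex.ofReal_zero).toSchwartzMap
    (Complex.ofRealCLM.contDiff.comp hsmooth)
  have hG : ∀ x, G x = g x := fun _ => rfl
  have hinv : ∀ ξ, ‖𝓕⁻ G ξ‖ ≤ ∫ x, g x := fun ξ => by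
    rw [SchwartzMap.fourierInv_coe, Real.fourierInv_eq_fourier_neg]
    refine (VectorFourier.norm_fourierIntegral_le_integral_norm _ _ _ _ _).trans_eq ?_
    simp_rw [hG, Complex.norm_real, Real.norm_of_nonneg (hg _)]
  have hparseval := integral_eq_integral_charFun_smul_fourierInv G P
  simp_rw [hG] at hparseval
  calc ∫ x, g x ∂P = ‖∫ x, (g x : ℂ) ∂P‖ := by
        rw [integral_complex_ofReal, Complex.norm_real,
          Real.norm_of_nonneg (integral_nonneg hg)]
    _ ≤ ∫ ξ, ‖charFun P ((-(2 * Real.pi)) • ξ)‖ * ∫ x, g x := by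
        rw [hparseval]
        refine norm_integral_le_of_norm_le
          ((hP.norm.comp_smul (neg_ne_zero.2 Real.two_pi_pos.ne')).mul_const _)
          (ae_of_all _ fun ξ => ?_)
        rw [norm_smul]
        exact mul_le_mul_of_nonneg_left (hinv ξ) (norm_nonneg _)
    _ = ∫ x, g x ∂(κ.toNNReal • volume) := by
        rw [integral_mul_const, hscale, integral_smul_nnreal_measure, NNReal.smul_def,
          Real.coe_toNNReal κ hκ, smul_eq_mul]

end FourierInversion

section DominatedMeasures

variable {E : Type*} [MeasurableSpace E]

theorem hasPDF_of_map_le_smul {Ω : Type*} [MeasurableSpace Ω]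
    {P : Measure Ω} [SFinite P] {μ : Measure E} [SigmaFinite μ] {X : Ω → E} {c : ℝ≥0∞}
    (hX : AEMeasurable X P) (h : P.map X ≤ c • μ) : HasPDF X P μ :=
  (hasPDF_iff_of_aemeasurable hX).2 ⟨inferInstance,
    (Measure.absolutelyContinuous_of_le h).trans Measure.smul_absolutelyContinuous⟩

theorem eLpNorm_pdf_top_le {Ω : Type*} [MeasurableSpace Ω]
    {P : Measure Ω} {μ : Measure E} [SigmaFinite μ] {X : Ω → E} {c : ℝ≥0∞}
    (h : P.map X ≤ c • μ) : eLpNorm (pdf X P μ) ∞ μ ≤ c := by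
  have hle : pdf X P μ ≤ᵐ[μ] fun _ => c := by
    refine ae_le_of_forall_setLIntegral_le_of_sigmaFinite (measurable_pdf X P μ) fun s _ _ => ?_
    rw [pdf_def, setLIntegral_const]
    exact (Measure.setLIntegral_rnDeriv_le s).trans (h s)
  rw [eLpNorm_exponent_top]
  exact eLpNormEssSup_le_of_ae_enorm_bound <|
    hle.mono fun x hx => by simpa only [enorm_eq_self] using hx

theorem measureReal_le_mul_of_le_ofReal_smul {P μ : Measure E}
    {c : ℝ} {s : Set E} (hc : 0 ≤ c) (h : P ≤ ENNReal.ofReal c • μ) (hs : μ s ≠ ∞) :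
    P.real s ≤ c * μ.real s := by
  refine ENNReal.toReal_le_of_le_ofReal (by positivity) ((h s).trans_eq ?_)
  rw [Measure.smul_apply, smul_eq_mul, ENNReal.ofReal_mul hc, ofReal_measureReal hs]

theorem restrict_le_restrict_of_subset {μ ν : Measure E}
    {s t t' : Set E} (h : μ.restrict s ≤ ν.restrict s) (hts : t ⊆ s) (htt' : t ⊆ t') :
    μ.restrict t ≤ ν.restrict t' :=
  calc μ.restrict t = (μ.restrict s).restrict t := (Measure.restrict_restrict_of_subset hts).symm
    _ ≤ (ν.restrict s).restrict t := Measure.restrict_mono_measure h t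
    _ = ν.restrict t := Measure.restrict_restrict_of_subset hts
    _ ≤ ν.restrict t' := Measure.restrict_mono_set ν htt'

end DominatedMeasures

section RegularVariation

theorem RegularlyVaryingAtTop.eventually_rpow_mul_le {φ : ℝ → ℝ} {ρ α s : ℝ}
    (hφ : RegularlyVaryingAtTop φ ρ) (hαρ : α < ρ) (hs : 1 < s) :
    ∀ᶠ x in atTop, s ^ α * φ x ≤ φ (s * x) := by
  have hlt : s ^ α < s ^ ρ := Real.rpow_lt_rpow_of_exponent_lt hs hαρ
  filter_upwards [(hφ.tendsto s (one_pos.trans hs)).eventually_const_lt hlt, eventually_gt_atTop 0]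
    with x hx hx0
  exact ((lt_div_iff₀ (hφ.pos x hx0)).1 hx).le

theorem exists_mul_rpow_le_of_monotoneOn {φ : ℝ → ℝ} {α s : ℝ} (hmono : MonotoneOn φ (Ioi 0))
    (hpos : ∀ x, 0 < x → 0 < φ x) (hα : 0 ≤ α) (hs : 1 < s)
    (hstep : ∀ᶠ x in atTop, s ^ α * φ x ≤ φ (s * x)) :
    ∃ c > 0, ∀ᶠ x in atTop, c * x ^ α ≤ φ x := by
  have hs0 : 0 < s := one_pos.trans hs
  obtain ⟨N, hN⟩ := eventually_atTop.1 (hstep.and (eventually_gt_atTop 0))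
  have hN0 : 0 < N := (hN N le_rfl).2
  have hφN : 0 < φ N := hpos N hN0
  set c : ℝ := φ N / (s * N) ^ α
  have hbase : ∀ x, N ≤ x → x ≤ s * N → c * x ^ α ≤ φ x := fun x hNx hx => by
    have hx0 : 0 < x := hN0.trans_le hNx
    calc c * x ^ α ≤ c * (s * N) ^ α := by gcongr
      _ = φ N := div_mul_cancel₀ _ (by positivity)
      _ ≤ φ x := hmono hN0 hx0 hNx
  have hpow : ∀ (n : ℕ) (x : ℝ), N ≤ x → x ≤ s ^ n * (s * N) → c * x ^ α ≤ φ x := by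
    intro n
    induction n with
    | zero => exact fun x hNx hx => hbase x hNx (by rwa [pow_zero, one_mul] at hx)
    | succ n ih =>
      intro x hNx hx
      rcases le_total x (s * N) with hxs | hxs
      · exact hbase x hNx hxs
      · have hNxs : N ≤ x / s := (le_div_iff₀' hs0).2 hxs
        have hxs0 : 0 < x / s := hN0.trans_le hNxs
        have hxn : x / s ≤ s ^ n * (s * N) := by
          rw [div_le_iff₀ hs0]
          exact hx.trans_eq (by ring)
        calc c * x ^ α = s ^ α * (c * (x / s) ^ α) := by
              rw [mul_left_comm, ← Real.mul_rpow hs0.le hxs0.le, mul_div_cancel₀ _ hs0.ne']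
          _ ≤ s ^ α * φ (x / s) := by gcongr; exact ih _ hNxs hxn
          _ ≤ φ (s * (x / s)) := (hN _ hNxs).1
          _ = φ x := by rw [mul_div_cancel₀ _ hs0.ne']
  refine ⟨c, by positivity, eventually_atTop.2 ⟨N, fun x hx => ?_⟩⟩
  obtain ⟨n, hn⟩ := pow_unbounded_of_one_lt (x / (s * N)) hs
  exact hpow n x hx ((div_lt_iff₀ (by positivity)).1 hn).le

theorem RegularlyVaryingAtTop.exists_mul_rpow_le_sub {φ : ℝ → ℝ} {ρ α s : ℝ}
    (hφ : RegularlyVaryingAtTop φ ρ) (hmono : MonotoneOn φ (Ioi 0)) (hα : 0 < α) (hαρ : α < ρ)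
    (hs : 1 < s) : ∃ c > 0, ∀ᶠ x in atTop, c * x ^ α ≤ φ (s * x) - φ x := by
  have hstep := hφ.eventually_rpow_mul_le hαρ hs
  obtain ⟨c, hc, hgrow⟩ := exists_mul_rpow_le_of_monotoneOn hmono hφ.pos hα.le hs hstep
  have hsα : 0 < s ^ α - 1 := sub_pos.2 (Real.one_lt_rpow hs hα)
  refine ⟨(s ^ α - 1) * c, by positivity, ?_⟩
  filter_upwards [hstep, hgrow] with x hxstep hxgrow
  calc (s ^ α - 1) * c * x ^ α = (s ^ α - 1) * (c * x ^ α) := mul_assoc _ _ _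
    _ ≤ (s ^ α - 1) * φ x := by gcongr
    _ ≤ φ (s * x) - φ x := by linarith

theorem exists_mul_rpow_le_measureReal_annulus {μ : Measure ℝ} {α ρ s : ℝ} (hα : 0 < α)
    (hαρ : α < ρ) (hs : 1 < s)
    (hμ : RegularlyVaryingAtZero (fun x => μ.real (Iic (-x) ∪ Ici x)) (-ρ)) :
    ∃ c > 0, ∀ᶠ u in atTop, c * u ^ α ≤ μ.real {x | 1 / (s * u) ≤ |x| ∧ |x| < 1 / u} := by
  have htail : ∀ r : ℝ, Iic (-r) ∪ Ici r = {x | r ≤ |x|} := fun r => by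
    ext x
    simp only [mem_union, mem_Iic, mem_Ici, mem_ofPred_eq, le_abs']
  unfold RegularlyVaryingAtZero at hμ
  simp only [htail, neg_neg] at hμ
  have hfin : ∀ u : ℝ, 0 < u → μ {x | 1 / u ≤ |x|} ≠ ∞ := fun u hu =>
    (ENNReal.toReal_ne_zero.1 (hμ.pos u hu).ne').2
  have htail_mono : ∀ {a b : ℝ}, 0 < a → a ≤ b →
      {x : ℝ | 1 / a ≤ |x|} ⊆ {x | 1 / b ≤ |x|} := fun ha hab x hx =>
    (one_div_le_one_div_of_le ha hab).trans hx
  have hmono : MonotoneOn (fun u : ℝ => μ.real {x | 1 / u ≤ |x|}) (Ioi 0) :=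
    fun a ha b hb hab => measureReal_mono (htail_mono ha hab) (hfin b hb)
  obtain ⟨c, hc, hgrow⟩ := hμ.exists_mul_rpow_le_sub hmono hα hαρ hs
  refine ⟨c, hc, ?_⟩
  filter_upwards [hgrow, eventually_gt_atTop 0] with u hu hu0
  have hsu : u ≤ s * u := le_mul_of_one_le_left hu0.le hs.le
  refine hu.trans_eq ?_
  rw [← measureReal_sdiff (htail_mono hu0 hsu) (measurableSet_le measurable_const measurable_norm)
    (hfin (s * u) (hu0.trans_le hsu))]
  congr 1
  ext x
  simp

end RegularVariation

section LevyExponent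

/-- The integrand `e^{iux} - 1 - iux 1_{|x| ≤ 1}` of the Lévy–Khintchine formula. -/
noncomputable def levyIntegrand (u x : ℝ) : ℂ :=
  Complex.exp (Complex.I * (u : ℂ) * (x : ℂ)) - 1
    - Complex.I * (u : ℂ) * (if |x| ≤ 1 then (x : ℂ) else 0)

theorem measurable_levyIntegrand (u : ℝ) : Measurable (levyIntegrand u) :=
  Measurable.sub (by fun_prop) <| measurable_const.mul <|
    Measurable.ite (measurableSet_le measurable_norm measurable_const)
      Complex.measurable_ofReal measurable_const

theorem norm_exp_I_mul_sub_one_sub_le (y : ℝ) :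
    ‖Complex.exp (Complex.I * y) - 1 - Complex.I * y‖ ≤ 2 * y ^ 2 := by
  have hnorm : ‖Complex.I * (y : ℂ)‖ = |y| := by simp
  rcases le_total |y| 1 with hy | hy
  · have htaylor := Complex.norm_exp_sub_one_sub_id_le (hnorm.trans_le hy)
    rw [hnorm, sq_abs] at htaylor
    linarith [sq_nonneg y]
  · calc ‖Complex.exp (Complex.I * y) - 1 - Complex.I * y‖
        ≤ ‖Complex.exp (Complex.I * y) - 1‖ + ‖Complex.I * (y : ℂ)‖ := norm_sub_le _ _
      _ ≤ |y| + |y| := add_le_add Real.norm_exp_I_mul_ofReal_sub_one_le hnorm.le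
      _ ≤ 2 * y ^ 2 := by nlinarith [sq_abs y]

theorem norm_levyIntegrand_le (u x : ℝ) :
    ‖levyIntegrand u x‖ ≤ 2 * (u ^ 2 + 1) * min (x ^ 2) 1 := by
  have hux : Complex.I * (u : ℂ) * (x : ℂ) = Complex.I * ((u * x : ℝ) : ℂ) := by
    push_cast
    ring
  by_cases hx : |x| ≤ 1
  · rw [levyIntegrand, if_pos hx, hux, min_eq_left ((sq_le_one_iff_abs_le_one x).2 hx)]
    refine (norm_exp_I_mul_sub_one_sub_le (u * x)).trans ?_
    linarith [mul_pow u x 2, sq_nonneg x]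
  · rw [levyIntegrand, if_neg hx, hux, mul_zero, sub_zero,
      min_eq_right ((one_le_sq_iff_one_le_abs x).2 (not_le.1 hx).le)]
    refine (norm_sub_le _ _).trans ?_
    rw [Complex.norm_exp_I_mul_ofReal, norm_one]
    linarith [sq_nonneg u]

theorem re_levyIntegrand (u x : ℝ) : (levyIntegrand u x).re = Real.cos (u * x) - 1 := by
  have hux : Complex.I * (u : ℂ) * (x : ℂ) = ((u * x : ℝ) : ℂ) * Complex.I := by
    push_cast
    ring
  rw [levyIntegrand, hux, Complex.sub_re, Complex.sub_re, Complex.exp_ofReal_mul_I_re]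
  split_ifs <;> simp

theorem IsLevyMeasure.integrable_levyIntegrand {ν : Measure ℝ} (hν : IsLevyMeasure ν) (u : ℝ) :
    Integrable (levyIntegrand u) ν := by
  have hmin : Integrable (fun x : ℝ => min (x ^ 2) 1) ν := by
    refine ⟨by fun_prop, ?_⟩
    rw [hasFiniteIntegral_iff_ofReal (ae_of_all _ fun x => by positivity)]
    exact hν.lintegral_lt_top
  exact (hmin.const_mul _).mono' (measurable_levyIntegrand u).aestronglyMeasurable
    (ae_of_all _ (norm_levyIntegrand_le u))

theorem IsLevyMeasure.integrable_one_sub_cos {ν : Measure ℝ} (hν : IsLevyMeasure ν) (u : ℝ) :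
    Integrable (fun x => 1 - Real.cos (u * x)) ν :=
  (hν.integrable_levyIntegrand u).re.neg.congr <| ae_of_all _ fun x => by
    simp only [Pi.neg_apply, RCLike.re_to_complex, re_levyIntegrand, neg_sub]

theorem IsLevyMeasure.re_levyExponent {ν : Measure ℝ} (hν : IsLevyMeasure ν) (c : ℝ) (σsq : ℝ≥0)
    (u : ℝ) :
    (levyExponent c σsq ν u).re = -(σsq * u ^ 2 / 2) - ∫ x, (1 - Real.cos (u * x)) ∂ν := by
  have hjumps : (∫ x, levyIntegrand u x ∂ν).re = -∫ x, (1 - Real.cos (u * x)) ∂ν := by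
    have hre := integral_re (hν.integrable_levyIntegrand u)
    simp only [RCLike.re_to_complex, re_levyIntegrand] at hre
    rw [← hre, ← integral_neg]
    simp only [neg_sub]
  have hdrift : (Complex.I * (c : ℂ) * (u : ℂ)).re = 0 := by simp
  have hgauss : (σsq : ℂ) * (u : ℂ) ^ 2 / 2 = ((σsq * u ^ 2 / 2 : ℝ) : ℂ) := by
    push_cast
    rfl
  change (Complex.I * (c : ℂ) * (u : ℂ) - (σsq : ℂ) * (u : ℂ) ^ 2 / 2
    + ∫ x, levyIntegrand u x ∂ν).re = _
  rw [Complex.add_re, Complex.sub_re, hdrift, hgauss, Complex.ofReal_re, hjumps, zero_sub,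
    sub_eq_add_neg]

theorem mul_measureReal_annulus_le_integral_one_sub_cos {μ ν : Measure ℝ} {r s u : ℝ}
    (hμν : μ.restrict (Ioo (-r) r) ≤ ν) (hint : Integrable (fun x => 1 - Real.cos (u * x)) ν)
    (hs : 0 < s) (hu : u ≠ 0) (hur : 1 / |u| ≤ r) :
    2 / (Real.pi * s) ^ 2 * μ.real {x | 1 / (s * |u|) ≤ |x| ∧ |x| < 1 / |u|}
      ≤ ∫ x, (1 - Real.cos (u * x)) ∂ν := by
  have hpi := Real.pi_pos
  have habs : 0 < |u| := abs_pos.2 hu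
  set A : Set ℝ := {x | 1 / (s * |u|) ≤ |x| ∧ |x| < 1 / |u|}
  have hAr : A ⊆ Ioo (-r) r := fun x hx => abs_lt.1 (hx.2.trans_le hur)
  have hcos : ∀ x ∈ A, 2 / (Real.pi * s) ^ 2 ≤ 1 - Real.cos (u * x) := fun x hx => by
    have hlt : |u * x| < 1 := by
      rw [abs_mul]
      exact (lt_div_iff₀' habs).1 hx.2
    have hge : 1 / s ≤ |u * x| := by
      rw [abs_mul, div_le_iff₀' hs, ← mul_assoc]
      exact (div_le_iff₀' (by positivity)).1 hx.1
    calc 2 / (Real.pi * s) ^ 2 = 2 / Real.pi ^ 2 * (1 / s) ^ 2 := by field_simp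
      _ ≤ 2 / Real.pi ^ 2 * |u * x| ^ 2 := by gcongr
      _ = 2 / Real.pi ^ 2 * (u * x) ^ 2 := by rw [sq_abs]
      _ ≤ 1 - Real.cos (u * x) := by
          linarith [Real.cos_le_one_sub_mul_cos_sq (hlt.le.trans (by linarith [Real.pi_gt_three]))]
  have hlevel : μ.real A ≤ ν.real {x | 2 / (Real.pi * s) ^ 2 ≤ 1 - Real.cos (u * x)} :=
    ENNReal.toReal_mono (hint.measure_ge_lt_top (by positivity)).ne <|
      calc μ A = μ.restrict (Ioo (-r) r) A := (Measure.restrict_eq_self μ hAr).symm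
        _ ≤ ν A := hμν A
        _ ≤ _ := measure_mono hcos
  exact (mul_le_mul_of_nonneg_left hlevel (by positivity)).trans <|
    mul_meas_ge_le_integral_of_nonneg
      (ae_of_all _ fun x => sub_nonneg.2 (Real.cos_le_one (u * x))) hint _

theorem exists_re_levyExponent_le {μ : Measure ℝ} {α ρ r : ℝ} (hα : 0 < α) (hαρ : α < ρ)
    (hr : 0 < r) (hμ : RegularlyVaryingAtZero (fun x => μ.real (Iic (-x) ∪ Ici x)) (-ρ)) :
    ∃ k > 0, ∃ N > 0, ∀ ν : Measure ℝ, IsLevyMeasure ν → μ.restrict (Ioo (-r) r) ≤ ν →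
      ∀ (c : ℝ) (σsq : ℝ≥0) (u : ℝ), N ≤ |u| →
        (levyExponent c σsq ν u).re ≤ -(k * |u| ^ α) := by
  obtain ⟨c₀, hc₀, hgrow⟩ := exists_mul_rpow_le_measureReal_annulus hα hαρ one_lt_two hμ
  obtain ⟨N, hN⟩ := eventually_atTop.1 (hgrow.and (eventually_ge_atTop (1 / r)))
  refine ⟨2 / (Real.pi * 2) ^ 2 * c₀, by positivity, max N 1, by positivity,
    fun ν hν hμν c σsq u hu => ?_⟩
  obtain ⟨hmass, hur⟩ := hN |u| ((le_max_left _ _).trans hu)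
  have hu0 : 0 < |u| := one_pos.trans_le ((le_max_right _ _).trans hu)
  have hjumps := mul_measureReal_annulus_le_integral_one_sub_cos hμν (hν.integrable_one_sub_cos u)
    two_pos (abs_pos.1 hu0) ((one_div_le hr hu0).1 hur)
  have hgauss : 0 ≤ (σsq : ℝ) * u ^ 2 / 2 := by positivity
  rw [hν.re_levyExponent]
  calc -(σsq * u ^ 2 / 2) - ∫ x, (1 - Real.cos (u * x)) ∂ν
      ≤ -(2 / (Real.pi * 2) ^ 2 * μ.real {x | 1 / (2 * |u|) ≤ |x| ∧ |x| < 1 / |u|}) := by linarith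
    _ ≤ -(2 / (Real.pi * 2) ^ 2 * (c₀ * |u| ^ α)) := by gcongr
    _ = -(2 / (Real.pi * 2) ^ 2 * c₀ * |u| ^ α) := by rw [mul_assoc]

end LevyExponent

section DensityBound

theorem integrable_comp_abs_of_integrableOn_Ioi {E : Type*} [NormedAddCommGroup E] {f : ℝ → E}
    (hf : IntegrableOn f (Ioi 0)) : Integrable (fun x => f |x|) := by
  have hIoi : IntegrableOn (fun x => f |x|) (Ioi 0) :=
    hf.congr_fun (fun x hx => by rw [abs_of_pos hx]) measurableSet_Ioi
  have hIic : IntegrableOn (fun x => f |x|) (Iic 0) := by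
    rw [integrableOn_Iic_iff_integrableOn_Iio]
    have hIoi' : IntegrableOn (fun x => f |x|) (Ioi (-0)) := by rwa [neg_zero]
    simpa only [abs_neg] using hIoi'.comp_neg_Iio
  rw [← integrableOn_univ, ← Iic_union_Ioi (a := (0 : ℝ))]
  exact hIic.union hIoi

theorem integrable_exp_neg_mul_abs_rpow {b α : ℝ} (hα : 0 < α) (hb : 0 < b) :
    Integrable (fun u : ℝ => Real.exp (-b * |u| ^ α)) := by
  have hIoi := integrableOn_rpow_mul_exp_neg_mul_rpow (s := 0) (by norm_num) hα hb
  simp only [Real.rpow_zero, one_mul] at hIoi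
  exact integrable_comp_abs_of_integrableOn_Ioi hIoi

theorem integral_exp_neg_mul_abs_rpow {b α : ℝ} (hα : 0 < α) (hb : 0 < b) :
    ∫ u : ℝ, Real.exp (-b * |u| ^ α) = 2 * (b ^ (-1 / α) * Real.Gamma (1 / α + 1)) := by
  rw [integral_comp_abs (f := fun x => Real.exp (-b * x ^ α)), integral_exp_neg_mul_rpow hα hb]

theorem integrable_charFun_and_integral_norm_charFun_le {P : Measure ℝ} [IsProbabilityMeasure P]
    {α b N : ℝ} (hα : 0 < α) (hb : 0 < b) (hN : 0 ≤ N)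
    (hP : ∀ u, N ≤ |u| → ‖charFun P u‖ ≤ Real.exp (-b * |u| ^ α)) :
    Integrable (charFun P) ∧
      ∫ u, ‖charFun P u‖ ≤ 2 * (N + b ^ (-1 / α) * Real.Gamma (1 / α + 1)) := by
  have hbound : ∀ u, ‖charFun P u‖ ≤ (Icc (-N) N).indicator 1 u + Real.exp (-b * |u| ^ α) := by
    intro u
    rcases le_or_gt N |u| with hu | hu
    · exact (hP u hu).trans (le_add_of_nonneg_left (indicator_nonneg (by simp) u))
    · rw [indicator_of_mem (mem_Icc.2 (abs_le.1 hu.le))]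
      exact (norm_charFun_le_one u).trans (le_add_of_nonneg_right (Real.exp_pos _).le)
  have hind : Integrable ((Icc (-N) N).indicator (1 : ℝ → ℝ)) :=
    (integrable_indicator_iff measurableSet_Icc).2 (integrableOn_const (by simp))
  have hexp := integrable_exp_neg_mul_abs_rpow hα hb
  refine ⟨(hind.add hexp).mono' measurable_charFun.aestronglyMeasurable (ae_of_all _ hbound), ?_⟩
  calc ∫ u, ‖charFun P u‖
      ≤ ∫ u, ((Icc (-N) N).indicator 1 u + Real.exp (-b * |u| ^ α)) :=
        integral_mono_of_nonneg (ae_of_all _ fun _ => norm_nonneg _) (hind.add hexp)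
          (ae_of_all _ hbound)
    _ = 2 * (N + b ^ (-1 / α) * Real.Gamma (1 / α + 1)) := by
        rw [integral_add hind hexp, integral_indicator_one measurableSet_Icc,
          integral_exp_neg_mul_abs_rpow hα hb, Real.volume_real_Icc_of_le (by linarith)]
        ring

theorem le_smul_volume_of_norm_charFun_le_exp {P : Measure ℝ} [IsProbabilityMeasure P]
    {α b N : ℝ} (hα : 0 < α) (hb : 0 < b) (hN : 0 ≤ N)
    (hP : ∀ u, N ≤ |u| → ‖charFun P u‖ ≤ Real.exp (-b * |u| ^ α)) :
    P ≤ ENNReal.ofReal ((N + b ^ (-1 / α) * Real.Gamma (1 / α + 1)) / Real.pi) • volume := by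
  obtain ⟨hint, hle⟩ := integrable_charFun_and_integral_norm_charFun_le hα hb hN hP
  refine (le_smul_volume_of_integrable_charFun hint).trans ?_
  have hpi := Real.pi_pos
  gcongr
  rw [Module.finrank_self, pow_one, ← div_eq_inv_mul, div_le_div_iff₀ Real.two_pi_pos hpi]
  nlinarith

theorem add_mul_rpow_mul_le_div_min {A B k t p : ℝ} (hA : 0 ≤ A) (hB : 0 ≤ B)
    (hk : 0 ≤ k) (ht : 0 < t) :
    A + (t * k) ^ (-p) * B ≤ (A + k ^ (-p) * B) / min (t ^ p) 1 := by
  have hmin : 0 < min (t ^ p) 1 := lt_min (by positivity) one_pos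
  rw [Real.mul_rpow ht.le hk, Real.rpow_neg ht.le, mul_assoc, add_div, div_eq_mul_inv,
    div_eq_inv_mul (_ * B)]
  have h1 : 1 ≤ (min (t ^ p) 1)⁻¹ := (one_le_inv₀ hmin).2 (min_le_right _ _)
  have h2 : (t ^ p)⁻¹ ≤ (min (t ^ p) 1)⁻¹ := inv_anti₀ hmin (min_le_left _ _)
  gcongr
  exact le_mul_of_one_le_right hA h1

theorem exists_map_le_smul_volume {μ : Measure ℝ} {α ρ r : ℝ} (hα : 0 < α) (hαρ : α < ρ)
    (hr : 0 < r) (hμ : RegularlyVaryingAtZero (fun x => μ.real (Iic (-x) ∪ Ici x)) (-ρ)) :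
    ∃ C > 0, ∀ ν : Measure ℝ, μ.restrict (Ioo (-r) r) ≤ ν → ∀ (c : ℝ) (σsq : ℝ≥0)
        (Ω : Type u) [MeasurableSpace Ω] (P : Measure Ω) [IsProbabilityMeasure P]
        (Y : ℝ≥0 → Ω → ℝ), IsLevyProcessWithTriplet Y P c σsq ν → ∀ t : ℝ≥0, 0 < t →
          P.map (Y t) ≤ ENNReal.ofReal (C / min ((t : ℝ) ^ (1 / α)) 1) • volume := by
  obtain ⟨k, hk, N, hN, hexponent⟩ := exists_re_levyExponent_le hα hαρ hr hμ
  have hΓ : 0 < Real.Gamma (1 / α + 1) := Real.Gamma_pos_of_pos (by positivity)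
  refine ⟨(N + k ^ (-(1 / α)) * Real.Gamma (1 / α + 1)) / Real.pi, by positivity,
    fun ν hμν c σsq Ω _ P _ Y hY t ht => ?_⟩
  have ht' : (0 : ℝ) < t := ht
  have := Measure.isProbabilityMeasure_map (μ := P) (hY.isLevyProcess.measurable t).aemeasurable
  have hcharFun : ∀ u, N ≤ |u| →
      ‖charFun (P.map (Y t)) u‖ ≤ Real.exp (-(t * k) * |u| ^ α) := fun u hu => by
    rw [hY.charFun_eq, Complex.norm_exp, Real.exp_le_exp]
    calc ((t : ℂ) * levyExponent c σsq ν u).re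
        = t * (levyExponent c σsq ν u).re := Complex.re_ofReal_mul _ _
      _ ≤ t * -(k * |u| ^ α) := by gcongr; exact hexponent ν hY.isLevyMeasure hμν c σsq u hu
      _ = -(t * k) * |u| ^ α := by ring
  refine (le_smul_volume_of_norm_charFun_le_exp hα (by positivity) hN.le hcharFun).trans ?_
  rw [neg_div, div_right_comm]
  gcongr
  exact add_mul_rpow_mul_le_div_min hN.le hΓ.le hk.le ht'

end DensityBound

theorem theorem2_general (ν μ : Measure ℝ) (c : ℝ) (σsq : ℝ≥0) (γ₀ α ρ : ℝ) (hγ₀ : 0 < γ₀)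
    (hα : 0 < α) (hαρ : α < ρ)
    (hμν : μ.restrict (Ioo (-γ₀) γ₀) ≤ ν.restrict (Ioo (-γ₀) γ₀))
    (hμ : RegularlyVaryingAtZero (fun x => μ.real (Iic (-x) ∪ Ici x)) (-ρ)) :
    (∃ C : ℝ, ∀ γ : ℝ, γ₀ ≤ γ →
      ∀ (Ω : Type u) [MeasurableSpace Ω] (P : Measure Ω) [IsProbabilityMeasure P]
        (Y : ℝ≥0 → Ω → ℝ), IsLevyProcessWithTriplet Y P c σsq (ν.restrict (Ioo (-γ) γ)) →
      ∀ t : ℝ≥0, 0 < t →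
        HasPDF (Y t) P volume ∧
          eLpNorm (pdf (Y t) P volume) ∞ volume
            ≤ ENNReal.ofReal (C / min ((t : ℝ) ^ (1 / α)) 1)) ∧
    SmallJumpAnticoncentration.{u} c σsq ν 1 := by
  refine ⟨?_, fun z₀ hz₀ => ?_⟩
  · obtain ⟨C, -, hdensity⟩ := exists_map_le_smul_volume.{u} hα hαρ hγ₀ hμ
    refine ⟨C, fun γ hγ Ω _ P _ Y hY t ht => ?_⟩
    have hjumps : μ.restrict (Ioo (-γ₀) γ₀) ≤ ν.restrict (Ioo (-γ) γ) :=
      restrict_le_restrict_of_subset hμν subset_rfl (Ioo_subset_Ioo (neg_le_neg hγ) hγ)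
    have hle := hdensity _ hjumps c σsq Ω P Y hY t ht
    exact ⟨hasPDF_of_map_le_smul (hY.isLevyProcess.measurable t).aemeasurable hle,
      eLpNorm_pdf_top_le hle⟩
  · obtain ⟨C, hC, hdensity⟩ := exists_map_le_smul_volume.{u} hα hαρ (lt_min hγ₀ hz₀) hμ
    refine ⟨C, hC, 1 / α, by positivity, fun z hz Ω _ P _ Y hY t ht x δ hδ => ?_⟩
    have hjumps : μ.restrict (Ioo (-min γ₀ z₀) (min γ₀ z₀)) ≤ ν.restrict (Iio z) :=
      restrict_le_restrict_of_subset hμν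
        (Ioo_subset_Ioo (neg_le_neg (min_le_left _ _)) (min_le_left _ _))
        fun y hy => hy.2.trans_le ((min_le_right _ _).trans hz)
    rw [Real.rpow_one]
    have hle := measureReal_le_mul_of_le_ofReal_smul (s := Icc x (x + δ)) (by positivity)
      (hdensity _ hjumps c σsq Ω P Y hY t ht) measure_Icc_lt_top.ne
    rwa [map_measureReal_apply (hY.isLevyProcess.measurable t) measurableSet_Icc,
      Real.volume_real_Icc_of_le (le_add_of_nonneg_right hδ.1), add_sub_cancel_left] at hle

/-- `ν` is the Lévy measure of a Lévy process `X` with triplet `(0, 0, ν)`; the process `X` enters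
only through `ν`. The first conclusion is about every Lévy process `Y = X^{<γ}` with triplet
`(0, 0, ν|_{(-γ, γ)})`, on any probability space: `Y t` has a density with respect to Lebesgue
measure, whose essential supremum is at most `C / (t^{1/α} ∧ 1)`. -/
theorem theorem2 (ν μ : Measure ℝ) (hν : IsLevyMeasure ν) (γ₀ α ε : ℝ) (hγ₀ : 0 < γ₀)
    (hα : α ∈ Ioo (0 : ℝ) 2) (hε : ε ∈ Ioo (0 : ℝ) (2 - α))
    (hμν : μ.restrict (Ioo (-γ₀) γ₀) ≤ ν.restrict (Ioo (-γ₀) γ₀))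
    (hμ : RegularlyVaryingAtZero (fun x => μ.real (Iic (-x) ∪ Ici x)) (-(α + ε))) :
    (∃ C : ℝ, ∀ γ : ℝ, γ₀ ≤ γ →
      ∀ (Ω : Type u) [MeasurableSpace Ω] (P : Measure Ω) [IsProbabilityMeasure P]
        (Y : ℝ≥0 → Ω → ℝ), IsLevyProcessWithTriplet Y P 0 0 (ν.restrict (Ioo (-γ) γ)) →
      ∀ t : ℝ≥0, 0 < t →
        HasPDF (Y t) P volume ∧
          eLpNorm (pdf (Y t) P volume) ∞ volume
            ≤ ENNReal.ofReal (C / min ((t : ℝ) ^ (1 / α)) 1)) ∧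
    SmallJumpAnticoncentration.{u} 0 0 ν 1 :=
  theorem2_general.{u} ν μ 0 0 γ₀ α (α + ε) hγ₀ hα.1 (lt_add_of_pos_right α hε.1) hμν hμ
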